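/- For a finite simple graph $G$ let $q(G)$, the signless Laplacian spectral radius of $G$, denote the largest eigenvalue of $A(G)+D(G)$, where $A(G)$ is the adjacency matrix and $D(G)$ the diagonal matrix of vertex degrees. Let $P_k$ denote the path on $k$ vertices; a graph is $P_k$-free if it has no (not necessarily induced) subgraph isomorphic to $P_k$. For integers $n,k,s$ with $s\ge 1$, $2s\le k-1$ and $n\ge k-1-s$, let $W_{n,k-1,s}=K_s\vee\big((n-k+s+1)K_1\cup K_{k-2s-1}\big)$, that is, the graph on $n$ vertices whose vertex set is partitioned into $X,Y,Z$ with $|X|=s$, $|Y|=k-1-2s$, $|Z|=n-(k-1-s)$, and whose edges are all pairs inside $X\cup Y$ and all pairs between $X$ and $Z$. Theorem 4.14. Let $n\ge k\ge 4$ and $t=\lfloor k/2\rfloor-1$. Let $G$ be an $n$-vertex $P_k$-free graph (not necessarily connected) whose signless Laplacian spectral radius is maximum among all $n$-vertex $P_k$-free graphs. Then $$q(G)=\max\big(\{q(W_{n,k-1,s}) : 1\le s\le t\}\cup\{q(K_{k-1})\}\big).$$ -/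

import Mathlib

/-- The signless Laplacian `A(G) + D(G)` of a finite simple graph, as a real matrix: `A(G)` is the
adjacency matrix and `D(G)` the diagonal matrix of degrees. -/
noncomputable def signlessLaplacian {V : Type*} [Fintype V] (G : SimpleGraph V) :
    Matrix V V ℝ := by
  classical exact G.adjMatrix ℝ + G.degMatrix ℝ

/-- The signless Laplacian spectral radius `q(G)`: the largest (real) eigenvalue of `A(G) + D(G)`.
For a nonempty vertex set this supremum is a maximum, see
`isGreatest_signlessLaplacianSpectralRadius`. -/
noncomputable def signlessLaplacianSpectralRadius {V : Type*} [Fintype V] (G : SimpleGraph V) : ℝ :=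
  sSup {μ : ℝ | ∃ x : V → ℝ, x ≠ 0 ∧ (signlessLaplacian G).mulVec x = μ • x}

/-- The supremum in the definition of `q(G)` is attained: `q(G)` is the largest eigenvalue. -/
theorem isGreatest_signlessLaplacianSpectralRadius {V : Type*} [Fintype V] [Nonempty V]
    (G : SimpleGraph V) :
    IsGreatest {μ : ℝ | ∃ x : V → ℝ, x ≠ 0 ∧ (signlessLaplacian G).mulVec x = μ • x}
      (signlessLaplacianSpectralRadius G) := by
  classical
  have hset : {μ : ℝ | ∃ x : V → ℝ, x ≠ 0 ∧ (signlessLaplacian G).mulVec x = μ • x} =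
      {μ : ℝ | Module.End.HasEigenvalue (Matrix.toLin' (signlessLaplacian G)) μ} := by
    ext μ
    constructor
    · rintro ⟨x, hx, h⟩
      exact Module.End.hasEigenvalue_of_hasEigenvector
        ⟨Module.End.mem_eigenspace_iff.2 (by simpa using h), hx⟩
    · intro h
      obtain ⟨x, hx, h0⟩ := h.exists_hasEigenvector
      exact ⟨x, h0, by simpa using Module.End.mem_eigenspace_iff.1 hx⟩
  have hfin : {μ : ℝ | ∃ x : V → ℝ, x ≠ 0 ∧
      (signlessLaplacian G).mulVec x = μ • x}.Finite := by
    rw [hset]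
    exact Module.End.finite_hasEigenvalue _
  have hH : (signlessLaplacian G).IsHermitian := by
    unfold signlessLaplacian
    exact (by simp [Matrix.IsHermitian] : (G.adjMatrix ℝ).IsHermitian).add
      (G.isHermitian_degMatrix (R := ℝ))
  have hne : {μ : ℝ | ∃ x : V → ℝ, x ≠ 0 ∧
      (signlessLaplacian G).mulVec x = μ • x}.Nonempty := by
    let i : V := Classical.arbitrary V
    refine ⟨hH.eigenvalues i, ⇑(hH.eigenvectorBasis i), ?_, hH.mulVec_eigenvectorBasis i⟩
    intro h
    refine hH.eigenvectorBasis.toBasis.ne_zero i ?_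
    ext j
    simpa using congrFun h j
  exact ⟨hne.csSup_mem hfin, fun _ hμ => le_csSup hfin.bddAbove hμ⟩

/-- The graph `W_{n,k,s} = K_s ∨ ((n-k+s) K_1 ∪ K_{k-2s})` on `n` vertices, for `2s ≤ k` and
`k - s ≤ n`. The vertices `0, …, n-1` are split into `X = {i < s}`, `Y = {s ≤ i < k - s}` and
`Z = {k - s ≤ i}`, of sizes `s`, `k - 2s` and `n - (k - s)`; the edges are all pairs inside `X ∪ Y`
and all pairs between `X` and `Z`. -/
def graphW (n k s : ℕ) : SimpleGraph (Fin n) where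
  Adj i j := i ≠ j ∧
    ((i.val < k - s ∧ j.val < k - s) ∨ (i.val < s ∧ k - s ≤ j.val) ∨ (k - s ≤ i.val ∧ j.val < s))
  symm := ⟨fun i j h => ⟨h.1.symm, by have := h.2; omega⟩⟩
  loopless := ⟨fun i h => h.1 rfl⟩

/-! By Rayleigh's principle `q(G)` is the maximum of `∑ (x u + x v) ^ 2` over edges, relative to `∑
x v ^ 2`, and it is attained at some nonnegative `x`. Order the vertices by decreasing `x`. A
Kelmans operation along an edge, towards its earlier end, does not lower this form
(`edgeForm_kelmans`) and creates no longer path (`hasPath_of_hasPath_kelmans`). Hence `G` may be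
replaced by a nested graph, that is, the ancestor-descendant graph of a rooted forest; the prior
neighbours of a vertex are its ancestors, and their number is its level.

Each tree of the forest is compared with one candidate. With fewer than `k` vertices it fits into
`K_{k-1}`. With more, partition the part below the root greedily into paths, always joining the two
longest paths below a vertex through that vertex. If `a ≥ b` are the two largest lengths, then `1 +
a + b < k`, since these two paths join through the root. An inequality between lengths and levels,
carried through the recursion as `LevelProfile`, yields `s ≥ 1` such that at most `k - 2 - 2s`
vertices have more than `s` ancestors. Since occupied levels have no gaps, these counts drop by at
least one per level until they vanish, so they are at most the corresponding counts in
`W_{n,k-1,s}`. As `x` is decreasing, moving ancestors to the front then bounds the form by that of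
`W_{n,k-1,s}` (`sum_levels_le`).

Conversely every candidate is `P_k`-free, so the maximality of `G` bounds it by `q(G)`. -/

open Finset

/-! ### Rayleigh quotients of the signless Laplacian -/

open Classical in
/-- The sum of `(x i + x j) ^ 2` over all ordered pairs of adjacent vertices. -/
noncomputable def edgeForm {V : Type*} [Fintype V] (G : SimpleGraph V) (x : V → ℝ) : ℝ :=
  ∑ i, ∑ j, if G.Adj i j then (x i + x j) ^ 2 else 0

theorem signlessLaplacian_isHermitian {V : Type*} [Fintype V] (G : SimpleGraph V) :
    (letI := Classical.decEq V; (signlessLaplacian G).IsHermitian) := by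
  classical
  unfold signlessLaplacian
  exact (by simp [Matrix.IsHermitian] : (G.adjMatrix ℝ).IsHermitian).add
    (G.isHermitian_degMatrix (R := ℝ))

open Classical in
theorem signlessLaplacian_mulVec_apply {V : Type*} [Fintype V] (G : SimpleGraph V) (x : V → ℝ)
    (i : V) : (signlessLaplacian G).mulVec x i = ∑ j, if G.Adj i j then x i + x j else 0 := by
  have h : (G.degree i : ℝ) = ∑ j, if G.Adj i j then 1 else 0 := by
    rw [Finset.sum_boole, ← SimpleGraph.card_neighborFinset_eq_degree,
      SimpleGraph.neighborFinset_eq_filter]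
  have e : signlessLaplacian G = G.adjMatrix ℝ + G.degMatrix ℝ := by
    unfold signlessLaplacian; congr
  rw [e, Matrix.add_mulVec, Pi.add_apply]
  simp only [SimpleGraph.degMatrix, Matrix.mulVec_diagonal]
  rw [h, Finset.sum_mul]
  simp only [Matrix.mulVec, dotProduct, SimpleGraph.adjMatrix_apply]
  rw [← Finset.sum_add_distrib]
  refine Finset.sum_congr rfl fun j _ => ?_
  split_ifs <;> ring

theorem edgeForm_eq_dotProduct {V : Type*} [Fintype V] (G : SimpleGraph V) (x : V → ℝ) :
    edgeForm G x = 2 * (x ⬝ᵥ (signlessLaplacian G).mulVec x) := by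
  classical
  have h1 : x ⬝ᵥ (signlessLaplacian G).mulVec x =
      ∑ i, ∑ j, if G.Adj i j then x i * (x i + x j) else 0 := by
    simp only [dotProduct, signlessLaplacian_mulVec_apply, Finset.mul_sum, mul_ite, mul_zero]
  have h2 : x ⬝ᵥ (signlessLaplacian G).mulVec x =
      ∑ i, ∑ j, if G.Adj i j then x j * (x i + x j) else 0 := by
    rw [h1, Finset.sum_comm]
    refine Finset.sum_congr rfl fun i _ => Finset.sum_congr rfl fun j _ => ?_
    rw [G.adj_comm, add_comm (x j)]
  rw [two_mul]
  nth_rw 1 [h1]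
  rw [h2, edgeForm, ← Finset.sum_add_distrib]
  refine Finset.sum_congr rfl fun i _ => ?_
  rw [← Finset.sum_add_distrib]
  refine Finset.sum_congr rfl fun j _ => ?_
  split_ifs <;> ring

/-- An eigenvector of `q • 1 - A` for `μ` is one of `A` for `q - μ ≤ q`, so `q • 1 - A` is positive
semidefinite. -/
theorem Matrix.IsHermitian.dotProduct_mulVec_le {V : Type*} [Fintype V] [DecidableEq V]
    {A : Matrix V V ℝ} (hA : A.IsHermitian) {q : ℝ} (hq : ∀ i, hA.eigenvalues i ≤ q) (x : V → ℝ) :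
    x ⬝ᵥ A.mulVec x ≤ q * ∑ i, x i ^ 2 := by
  have h : (q • (1 : Matrix V V ℝ) - A).PosSemidef := by
    have hB : (q • (1 : Matrix V V ℝ) - A).IsHermitian := by
      refine Matrix.IsHermitian.sub ?_ hA
      simp [Matrix.IsHermitian]
    rw [hB.posSemidef_iff_eigenvalues_nonneg]
    intro i
    have h1 := hB.mulVec_eigenvectorBasis i
    set v : V → ℝ := ⇑(hB.eigenvectorBasis i) with hv
    have hv0 : v ≠ 0 := by
      intro h
      refine hB.eigenvectorBasis.toBasis.ne_zero i ?_
      ext j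
      simpa using congrFun h j
    have h2 : A.mulVec v = (q - hB.eigenvalues i) • v := by
      rw [Matrix.sub_mulVec, Matrix.smul_mulVec, Matrix.one_mulVec] at h1
      rw [sub_smul, ← h1]; abel
    have h3 : q - hB.eigenvalues i ∈ spectrum ℝ A := by
      rw [← Matrix.spectrum_toLin']
      apply Module.End.HasEigenvalue.mem_spectrum
      exact Module.End.hasEigenvalue_of_hasEigenvector
        ⟨Module.End.mem_eigenspace_iff.2 (by simpa using h2), hv0⟩
    rw [hA.spectrum_real_eq_range_eigenvalues] at h3
    obtain ⟨j, hj⟩ := h3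
    have := hq j
    simp only [Pi.zero_apply]
    linarith
  have h4 := h.dotProduct_mulVec_nonneg x
  rw [Matrix.sub_mulVec, Matrix.smul_mulVec, Matrix.one_mulVec, dotProduct_sub,
    dotProduct_smul] at h4
  have h5 : x ⬝ᵥ x = ∑ i, x i ^ 2 := by simp [dotProduct, sq]
  simp only [star_trivial, smul_eq_mul, h5] at h4
  linarith

theorem edgeForm_le {V : Type*} [Fintype V] (G : SimpleGraph V) (x : V → ℝ) :
    edgeForm G x ≤ 2 * (signlessLaplacianSpectralRadius G * ∑ i, x i ^ 2) := by
  classical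
  rcases isEmpty_or_nonempty V with hV | hV
  · simp [edgeForm]
  rw [edgeForm_eq_dotProduct]
  have hH : (signlessLaplacian G).IsHermitian := by
    convert signlessLaplacian_isHermitian G
  have := hH.dotProduct_mulVec_le (q := signlessLaplacianSpectralRadius G) (fun i => by
    refine (isGreatest_signlessLaplacianSpectralRadius G).2
      ⟨⇑(hH.eigenvectorBasis i), ?_, hH.mulVec_eigenvectorBasis i⟩
    intro h
    refine hH.eigenvectorBasis.toBasis.ne_zero i ?_
    ext j
    simpa using congrFun h j) x
  linarith

/-- Passing from a top eigenvector to its entrywise absolute value keeps the norm and can only raise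
each `(x i + x j) ^ 2`. -/
theorem exists_nonneg_le_edgeForm {V : Type*} [Fintype V] [Nonempty V] (G : SimpleGraph V) :
    ∃ x : V → ℝ, (∀ i, 0 ≤ x i) ∧ 0 < ∑ i, x i ^ 2 ∧
      2 * (signlessLaplacianSpectralRadius G * ∑ i, x i ^ 2) ≤ edgeForm G x := by
  classical
  obtain ⟨x, hx, h⟩ := (isGreatest_signlessLaplacianSpectralRadius G).1
  refine ⟨fun i => |x i|, fun i => abs_nonneg _, ?_, ?_⟩
  · obtain ⟨i, hi⟩ := Function.ne_iff.1 hx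
    exact Finset.sum_pos' (fun i _ => sq_nonneg _)
      ⟨i, Finset.mem_univ i, by simpa using pow_pos (abs_pos.2 hi) 2⟩
  · have h1 := edgeForm_eq_dotProduct G x
    rw [h, dotProduct_smul] at h1
    have h5 : x ⬝ᵥ x = ∑ i, |x i| ^ 2 := by simp [dotProduct, sq]
    rw [h5, smul_eq_mul] at h1
    rw [← h1]
    refine Finset.sum_le_sum fun i _ => Finset.sum_le_sum fun j _ => ?_
    split_ifs
    · rw [← sq_abs (x i + x j)]
      exact pow_le_pow_left₀ (abs_nonneg _) (abs_add_le _ _) 2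
    · rfl

/-- A nonnegative top vector of `G`, extended by zero along `f`, is a trial vector for `H`. -/
theorem signlessLaplacianSpectralRadius_le_of_injective_hom {V W : Type*} [Fintype V] [Nonempty V]
    [Fintype W] {G : SimpleGraph V} {H : SimpleGraph W} (f : V → W) (hf : Function.Injective f)
    (hadj : ∀ i j, G.Adj i j → H.Adj (f i) (f j)) :
    signlessLaplacianSpectralRadius G ≤ signlessLaplacianSpectralRadius H := by
  classical
  obtain ⟨x, hx0, hx1, hx2⟩ := exists_nonneg_le_edgeForm G
  have hz : ∀ i, Function.extend f x 0 (f i) = x i := fun i => hf.extend_apply x 0 i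
  have hsum : ∑ j, Function.extend f x 0 j ^ 2 = ∑ i, x i ^ 2 := by
    symm
    refine Finset.sum_of_injOn f hf.injOn (by simp) (fun j _ hj => ?_) (fun i _ => by rw [hz])
    rw [Function.extend_apply' _ _ _ (fun ⟨a, ha⟩ => hj ⟨a, by simp, ha⟩)]
    simp
  have hform : edgeForm G x ≤ edgeForm H (Function.extend f x 0) := by
    unfold edgeForm
    calc _ ≤ ∑ i, ∑ j, if H.Adj (f i) (f j) then
          (Function.extend f x 0 (f i) + Function.extend f x 0 (f j)) ^ 2 else 0 := by
          refine Finset.sum_le_sum fun i _ => Finset.sum_le_sum fun j _ => ?_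
          rw [hz, hz]
          by_cases h : G.Adj i j
          · rw [if_pos h, if_pos (hadj i j h)]
          · rw [if_neg h]; split_ifs <;> positivity
      _ ≤ ∑ i, ∑ b, if H.Adj (f i) b then
          (Function.extend f x 0 (f i) + Function.extend f x 0 b) ^ 2 else 0 := by
          refine Finset.sum_le_sum fun i _ => ?_
          rw [← Finset.sum_image (s := Finset.univ) (g := f)
            (f := fun b => if H.Adj (f i) b then
              (Function.extend f x 0 (f i) + Function.extend f x 0 b) ^ 2 else 0) hf.injOn]
          exact Finset.sum_le_sum_of_subset_of_nonneg (Finset.subset_univ _)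
            (fun _ _ _ => by split_ifs <;> positivity)
      _ ≤ _ := by
          rw [← Finset.sum_image (s := Finset.univ) (g := f)
            (f := fun a => ∑ b, if H.Adj a b then
              (Function.extend f x 0 a + Function.extend f x 0 b) ^ 2 else 0) hf.injOn]
          exact Finset.sum_le_sum_of_subset_of_nonneg (Finset.subset_univ _)
            (fun _ _ _ => Finset.sum_nonneg fun _ _ => by split_ifs <;> positivity)
  have h := edgeForm_le H (Function.extend f x 0)
  rw [hsum] at h
  have : signlessLaplacianSpectralRadius G * ∑ i, x i ^ 2 ≤
      signlessLaplacianSpectralRadius H * ∑ i, x i ^ 2 := by linarith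
  exact le_of_mul_le_mul_right this hx1

/-! ### Kelmans operations and paths -/

/-- `G` has a path on at least `k` vertices. -/
def HasPath {V : Type*} (G : SimpleGraph V) (k : ℕ) : Prop :=
  ∃ l : List V, l.Nodup ∧ l.IsChain G.Adj ∧ k ≤ l.length

theorem pathGraph_isContained_iff_hasPath {V : Type*} {G : SimpleGraph V} {k : ℕ} :
    (SimpleGraph.pathGraph k).IsContained G ↔ HasPath G k := by
  constructor
  · rintro ⟨f⟩
    refine ⟨List.ofFn f, List.nodup_ofFn.2 f.injective, ?_, by simp⟩
    rw [List.isChain_iff_getElem]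
    intro i hi
    simp only [List.getElem_ofFn]
    exact f.toHom.map_adj (SimpleGraph.pathGraph_adj.2 (Or.inl rfl))
  · rintro ⟨l, hnd, hc, hk⟩
    have hlt : ∀ i : Fin k, i.val < l.length := fun i => i.2.trans_le hk
    refine ⟨⟨⟨fun i => l[i.val]'(hlt i), ?_⟩, ?_⟩⟩
    · intro i j hij
      rw [List.isChain_iff_getElem] at hc
      rcases SimpleGraph.pathGraph_adj.1 hij with h | h
      · have := hc i.val (by have := hlt j; omega)
        simpa [h] using this
      · have := hc j.val (by have := hlt i; omega)
        simpa [h] using this.symm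
    · intro i j hij
      exact Fin.ext ((hnd.getElem_inj_iff).1 hij)

/-- The Kelmans operation from `v` to `u`: every neighbour of `v` that is not a neighbour of `u`
is detached from `v` and attached to `u`. -/
def kelmans {V : Type*} (G : SimpleGraph V) (u v : V) : SimpleGraph V where
  Adj i j := (G.Adj i j ∧ ¬ (i = v ∧ j ≠ u ∧ ¬ G.Adj u j) ∧ ¬ (j = v ∧ i ≠ u ∧ ¬ G.Adj u i)) ∨
    (i = u ∧ j ≠ u ∧ j ≠ v ∧ G.Adj v j) ∨ (j = u ∧ i ≠ u ∧ i ≠ v ∧ G.Adj v i)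
  symm := ⟨fun i j h => by
    rcases h with ⟨h1, h2, h3⟩ | h | h
    · exact Or.inl ⟨h1.symm, h3, h2⟩
    · exact Or.inr (Or.inr h)
    · exact Or.inr (Or.inl h)⟩
  loopless := ⟨fun i h => by
    rcases h with ⟨h1, -⟩ | ⟨h1, h2, -⟩ | ⟨h1, h2, -⟩
    · exact G.loopless.irrefl i h1
    · exact h2 h1
    · exact h2 h1⟩

section
variable {V : Type*} {G : SimpleGraph V} {u v : V}

theorem adj_of_kelmans_adj {i j : V} (h : (kelmans G u v).Adj i j) (hi : i ≠ u) (hj : j ≠ u) :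
    G.Adj i j := by
  rcases h with h | h | h
  · exact h.1
  · exact absurd h.1 hi
  · exact absurd h.1 hj

theorem kelmans_adj_right {j : V} (h : (kelmans G u v).Adj v j) (hj : j ≠ u) (huv : u ≠ v) :
    G.Adj u j ∧ G.Adj v j := by
  rcases h with ⟨h1, h2, -⟩ | h | h
  · exact ⟨by_contra fun h => h2 ⟨rfl, hj, h⟩, h1⟩
  · exact absurd h.1 huv.symm
  · exact absurd h.1 hj

theorem kelmans_adj_left {j : V} (h : (kelmans G u v).Adj u j) :
    G.Adj u j ∨ G.Adj v j := by
  rcases h with h | h | h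
  · exact Or.inl h.1
  · exact Or.inr h.2.2.2
  · exact absurd rfl h.2.1

theorem List.isChain_reverse_append_cons_iff {R : V → V → Prop} (hR : ∀ x y, R x y → R y x)
    {a d : List V} {x : V} :
    (a.reverse ++ x :: d).IsChain R ↔ a.IsChain R ∧ d.IsChain R ∧ (∀ z ∈ a.head?, R x z) ∧
      (∀ z ∈ d.head?, R x z) := by
  have hsym : (fun a b => R b a) = R := by
    ext a b; exact ⟨fun h => hR _ _ h, fun h => hR _ _ h⟩
  rw [List.isChain_append, List.isChain_cons, List.isChain_reverse, hsym]
  simp only [List.getLast?_reverse, List.head?_cons, Option.mem_some_iff, forall_eq']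
  constructor
  · rintro ⟨h1, ⟨h2, h3⟩, h4⟩
    exact ⟨h1, h3, fun z hz => hR _ _ (h4 z hz), h2⟩
  · rintro ⟨h1, h2, h3, h4⟩
    exact ⟨h1, ⟨h4, h2⟩, fun z hz => hR _ _ (h3 z hz)⟩

theorem List.isChain_append_cons_iff {R : V → V → Prop} {c d : List V} {y : V} :
    (c ++ y :: d).IsChain R ↔ c.IsChain R ∧ d.IsChain R ∧ (∀ z ∈ c.getLast?, R z y) ∧
      (∀ z ∈ d.head?, R y z) := by
  rw [List.isChain_append, List.isChain_cons]
  simp only [List.head?_cons, Option.mem_some_iff, forall_eq']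
  tauto

theorem List.isChain_two_cuts_iff {R : V → V → Prop} (hR : ∀ x y, R x y → R y x)
    {a c d : List V} {x y : V} :
    (a.reverse ++ x :: (c ++ y :: d)).IsChain R ↔ a.IsChain R ∧ c.IsChain R ∧ d.IsChain R ∧
      (∀ z ∈ a.head?, R x z) ∧ (∀ z ∈ c.head?, R x z) ∧ (∀ z ∈ c.getLast?, R z y) ∧
      (∀ z ∈ d.head?, R y z) ∧ (c = [] → R x y) := by
  rw [List.isChain_reverse_append_cons_iff hR, List.isChain_append_cons_iff]
  cases c with
  | nil => simp; tauto
  | cons b c => simp; tauto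

/-- Segments of the path that avoid `u` survive in `G`. An edge from `v` to a vertex other than `u`
ends in a common neighbour of `u` and `v`, while an edge from `u` may belong to either in `G`.
Exchanging `u` and `v`, reversing the segment between them, or inserting a missing `v` next to `u`
repairs the path. -/
theorem hasPath_of_kelmans_path_aux (huv : G.Adj u v) {a l : List V}
    (hnd : (a.reverse ++ u :: l).Nodup) (hc : (a.reverse ++ u :: l).IsChain (kelmans G u v).Adj)
    (hva : v ∉ a) : HasPath G (a.reverse ++ u :: l).length := by
  have hne : u ≠ v := huv.ne
  have hua : u ∉ a := by
    intro h
    rw [List.nodup_append] at hnd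
    exact hnd.2.2 u (by simpa using h) u (by simp) rfl
  have hul : u ∉ l := by
    intro h
    simp [List.nodup_append, h] at hnd
  have hchain : ∀ m : List V, u ∉ m → m.IsChain (kelmans G u v).Adj → m.IsChain G.Adj := by
    intro m hm h
    refine List.IsChain.imp_of_mem_imp (fun i j hi hj hij => ?_) h
    exact adj_of_kelmans_adj hij (fun h => hm (h ▸ hi)) (fun h => hm (h ▸ hj))
  have hhead : ∀ m : List V, (∀ z ∈ m.head?, (kelmans G u v).Adj u z) →
      (∀ z ∈ m.head?, G.Adj u z) ∨ (∀ z ∈ m.head?, G.Adj v z) := by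
    intro m h
    cases m with
    | nil => simp
    | cons b m =>
      simp only [List.head?_cons, Option.mem_some_iff, forall_eq'] at h ⊢
      exact kelmans_adj_left h
  have hS : ∀ x y, G.Adj x y → G.Adj y x := fun _ _ h => h.symm
  have hS' : ∀ x y, (kelmans G u v).Adj x y → (kelmans G u v).Adj y x := fun _ _ h => h.symm
  by_cases hvl : v ∈ l
  · obtain ⟨c, d, rfl⟩ := List.append_of_mem hvl
    rw [List.isChain_two_cuts_iff hS'] at hc
    obtain ⟨h1, h2, h3, h4, h5, h6, h7, -⟩ := hc
    have huc : u ∉ c := fun h => hul (by simp [h])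
    have hud : u ∉ d := fun h => hul (by simp [h])
    replace h1 := hchain a hua h1
    replace h2 := hchain c huc h2
    replace h3 := hchain d hud h3
    have h2r : c.reverse.IsChain G.Adj := by
      rw [List.isChain_reverse]
      exact h2.imp fun _ _ h => h.symm
    have h6' : ∀ z ∈ c.getLast?, G.Adj u z ∧ G.Adj v z := fun z hz =>
      kelmans_adj_right (h6 z hz).symm (fun h => huc (h ▸ List.mem_of_mem_getLast? hz)) hne
    have h7' : ∀ z ∈ d.head?, G.Adj u z ∧ G.Adj v z := fun z hz =>
      kelmans_adj_right (h7 z hz) (fun h => hud (h ▸ List.mem_of_mem_head? hz)) hne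
    have key : ∀ x y c', ((x = u ∧ y = v) ∨ (x = v ∧ y = u)) → c'.Perm c →
        (a.reverse ++ x :: (c' ++ y :: d)).IsChain G.Adj →
        HasPath G (a.reverse ++ u :: (c ++ v :: d)).length := by
      intro x y c' hxy hc' h
      have hp : (a.reverse ++ x :: (c' ++ y :: d)).Perm (a.reverse ++ u :: (c ++ v :: d)) := by
        refine List.Perm.append_left _ ?_
        rcases hxy with ⟨rfl, rfl⟩ | ⟨rfl, rfl⟩
        · exact List.Perm.cons _ (List.Perm.append_right _ hc')
        · refine (List.Perm.cons _ (List.perm_middle.trans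
            (List.Perm.cons _ (List.Perm.append_right _ hc')))).trans ?_
          exact (List.Perm.swap _ _ _).trans (List.Perm.cons _ List.perm_middle.symm)
      exact ⟨_, hp.nodup_iff.2 hnd, h, hp.length_eq.ge⟩
    -- The head of `a` decides which of `u`, `v` comes first; `c` is reversed when its head belongs
    -- to the other one. The remaining junctions are at common neighbours.
    rcases hhead a h4 with ha | ha <;> rcases hhead c h5 with hcc | hcc
    · exact key u v c (Or.inl ⟨rfl, rfl⟩) (List.Perm.refl _)
        ((List.isChain_two_cuts_iff hS).2 ⟨h1, h2, h3, ha, hcc, fun z hz => (h6' z hz).2.symm,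
          fun z hz => (h7' z hz).2, fun _ => huv⟩)
    · refine key u v c.reverse (Or.inl ⟨rfl, rfl⟩) (List.reverse_perm _)
        ((List.isChain_two_cuts_iff hS).2 ⟨h1, h2r, h3, ha, fun z hz => ?_, fun z hz => ?_,
          fun z hz => (h7' z hz).2, fun _ => huv⟩)
      · rw [List.head?_reverse] at hz
        exact (h6' z hz).1
      · rw [List.getLast?_reverse] at hz
        exact (hcc z hz).symm
    · refine key v u c.reverse (Or.inr ⟨rfl, rfl⟩) (List.reverse_perm _)
        ((List.isChain_two_cuts_iff hS).2 ⟨h1, h2r, h3, ha, fun z hz => ?_, fun z hz => ?_,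
          fun z hz => (h7' z hz).1, fun _ => huv.symm⟩)
      · rw [List.head?_reverse] at hz
        exact (h6' z hz).2
      · rw [List.getLast?_reverse] at hz
        exact (hcc z hz).symm
    · exact key v u c (Or.inr ⟨rfl, rfl⟩) (List.Perm.refl _)
        ((List.isChain_two_cuts_iff hS).2 ⟨h1, h2, h3, ha, hcc, fun z hz => (h6' z hz).1.symm,
          fun z hz => (h7' z hz).1, fun _ => huv.symm⟩)
  · rw [List.isChain_reverse_append_cons_iff hS'] at hc
    obtain ⟨h1, h2, h3, h4⟩ := hc
    replace h1 := hchain a hua h1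
    replace h2 := hchain l hul h2
    have hins : ∀ x y, ((x = u ∧ y = v) ∨ (x = v ∧ y = u)) →
        (a.reverse ++ x :: ([] ++ y :: l)).IsChain G.Adj →
        HasPath G (a.reverse ++ u :: l).length := by
      intro x y hxy h
      refine ⟨_, ?_, h, by simp⟩
      have hp : (a.reverse ++ x :: ([] ++ y :: l)).Perm (v :: (a.reverse ++ u :: l)) := by
        rcases hxy with ⟨rfl, rfl⟩ | ⟨rfl, rfl⟩
        · exact (List.Perm.append_left _ (List.Perm.swap _ _ _)).trans List.perm_middle
        · exact List.perm_middle
      rw [hp.nodup_iff, List.nodup_cons]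
      exact ⟨by simp [hva, hvl, hne.symm], hnd⟩
    rcases hhead a h3 with ha | ha <;> rcases hhead l h4 with hl | hl
    · exact ⟨_, hnd, (List.isChain_reverse_append_cons_iff hS).2 ⟨h1, h2, ha, hl⟩, le_rfl⟩
    · exact hins u v (Or.inl ⟨rfl, rfl⟩) ((List.isChain_two_cuts_iff hS).2
        ⟨h1, List.isChain_nil, h2, ha, by simp, by simp, hl, fun _ => huv⟩)
    · exact hins v u (Or.inr ⟨rfl, rfl⟩) ((List.isChain_two_cuts_iff hS).2
        ⟨h1, List.isChain_nil, h2, ha, by simp, by simp, hl, fun _ => huv.symm⟩)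
    · refine ⟨a.reverse ++ v :: l, ?_,
        (List.isChain_reverse_append_cons_iff hS).2 ⟨h1, h2, ha, hl⟩, by simp⟩
      rw [List.perm_middle.nodup_iff, List.nodup_cons] at hnd ⊢
      exact ⟨by simp [hva, hvl], hnd.2⟩

/-- The Kelmans operation along an edge creates no longer path. -/
theorem hasPath_of_hasPath_kelmans (huv : G.Adj u v) {k : ℕ} (h : HasPath (kelmans G u v) k) :
    HasPath G k := by
  obtain ⟨p, hnd, hc, hk⟩ := h
  suffices HasPath G p.length by
    obtain ⟨q, h1, h2, h3⟩ := this
    exact ⟨q, h1, h2, hk.trans h3⟩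
  by_cases hu : u ∈ p
  · obtain ⟨a, l, rfl⟩ := List.append_of_mem hu
    by_cases hv : v ∈ a
    · have hvl : v ∉ l := by
        intro h
        rw [List.nodup_append] at hnd
        exact hnd.2.2 v hv v (by simp [h]) rfl
      have hrev : (l.reverse ++ u :: a.reverse) = (a ++ u :: l).reverse := by simp
      have := hasPath_of_kelmans_path_aux huv (a := l) (l := a.reverse)
        (by rw [hrev]; exact List.nodup_reverse.2 hnd)
        (by rw [hrev, List.isChain_reverse]; exact hc.imp fun _ _ h => h.symm) hvl
      rwa [hrev, List.length_reverse] at this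
    · have := hasPath_of_kelmans_path_aux huv (a := a.reverse) (l := l)
        (by simpa using hnd) (by simpa using hc) (by simpa using hv)
      simpa using this
  · exact ⟨p, hnd, List.IsChain.imp_of_mem_imp (fun i j hi hj hij =>
      adj_of_kelmans_adj hij (fun h => hu (by rwa [← h])) (fun h => hu (by rwa [← h]))) hc, le_rfl⟩

end

/-! ### Kelmans operations and the edge form -/

open Classical in
theorem edgeForm_eq_sum_filter {V : Type*} [Fintype V] (G : SimpleGraph V) (x : V → ℝ) :
    edgeForm G x = ∑ e : V × V with G.Adj e.1 e.2, (x e.1 + x e.2) ^ 2 := by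
  rw [Finset.sum_filter, Fintype.sum_prod_type]
  rfl

/-- The Kelmans operation towards a vertex of larger weight increases the edge form. -/
theorem edgeForm_kelmans {V : Type*} [Fintype V] (G : SimpleGraph V) {u v : V} (huv : u ≠ v)
    (x : V → ℝ) (hx : ∀ i, 0 ≤ x i) (hle : x v ≤ x u) :
    edgeForm G x ≤ edgeForm (kelmans G u v) x ∧
    (x v < x u → (∃ b, b ≠ u ∧ G.Adj v b ∧ ¬ G.Adj u b) →
      edgeForm G x < edgeForm (kelmans G u v) x) := by
  classical
  -- Moved edges land on pairs at `u` that are not edges of `G`, hence injectivity.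
  let τ : V × V → V × V := fun e =>
    if e.1 = v ∧ e.2 ≠ u ∧ ¬ G.Adj u e.2 then (u, e.2) else
    if e.2 = v ∧ e.1 ≠ u ∧ ¬ G.Adj u e.1 then (e.1, u) else e
  set E := Finset.univ.filter fun e : V × V => G.Adj e.1 e.2 with hE
  set E' := Finset.univ.filter fun e : V × V => (kelmans G u v).Adj e.1 e.2 with hE'
  have hmaps : ∀ e ∈ E, τ e ∈ E' := by
    rintro ⟨i, j⟩ he
    simp only [hE, hE', Finset.mem_filter, Finset.mem_univ, true_and, τ] at he ⊢
    split_ifs with h1 h2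
    · obtain ⟨rfl, h3, h4⟩ := h1
      exact Or.inr (Or.inl ⟨rfl, h3, he.ne.symm, he⟩)
    · obtain ⟨rfl, h3, h4⟩ := h2
      exact Or.inr (Or.inr ⟨rfl, h3, he.ne, he.symm⟩)
    · exact Or.inl ⟨he, h1, h2⟩
  have hinj : Set.InjOn τ E := by
    rintro ⟨i, j⟩ he ⟨i', j'⟩ he' h
    simp only [hE, Finset.coe_filter, Finset.mem_univ, true_and, Set.mem_ofPred_eq] at he he'
    have hs := he.symm
    have hs' := he'.symm
    simp only [τ] at h
    split_ifs at h <;> simp only [Prod.mk.injEq] at h ⊢ <;> grind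
  have hw : ∀ e ∈ E, (x e.1 + x e.2) ^ 2 ≤ (x (τ e).1 + x (τ e).2) ^ 2 := by
    rintro ⟨i, j⟩ -
    have := hx i
    have := hx j
    simp only [τ]
    split_ifs with h1 h2
    · obtain ⟨rfl, -⟩ := h1
      simp only
      gcongr
    · obtain ⟨rfl, -⟩ := h2
      simp only
      gcongr
    · rfl
  have hfin : ∑ e ∈ E, (x (τ e).1 + x (τ e).2) ^ 2 ≤ ∑ e ∈ E', (x e.1 + x e.2) ^ 2 := by
    rw [← Finset.sum_image (s := E) (g := τ) (f := fun e => (x e.1 + x e.2) ^ 2) hinj]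
    refine Finset.sum_le_sum_of_subset_of_nonneg (Finset.image_subset_iff.2 hmaps)
      fun _ _ _ => sq_nonneg _
  rw [edgeForm_eq_sum_filter, edgeForm_eq_sum_filter]
  refine ⟨(Finset.sum_le_sum hw).trans hfin, fun hlt ⟨b, hb1, hb2, hb3⟩ => ?_⟩
  refine (Finset.sum_lt_sum hw ⟨(v, b), by simpa [hE] using hb2, ?_⟩).trans_le hfin
  have hτ : τ (v, b) = (u, b) := by simp [τ, hb1, hb3]
  rw [hτ]
  have := hx b
  have := hx v
  simp only
  gcongr

/-- In a nested graph the earlier end of an edge dominates the later one. -/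
def IsNested {V : Type*} [LinearOrder V] (G : SimpleGraph V) : Prop :=
  ∀ u v, u < v → G.Adj u v → ∀ b, b ≠ u → G.Adj v b → G.Adj u b

/-- Kelmans operations turn a graph into a nested one without creating longer paths or decreasing
the edge form of a given antitone weight. -/
theorem exists_isNested {n k : ℕ} (G : SimpleGraph (Fin n)) (hG : ¬ HasPath G k) (x : Fin n → ℝ)
    (hx : ∀ i, 0 ≤ x i) (hanti : Antitone x) :
    ∃ H : SimpleGraph (Fin n), IsNested H ∧ ¬ HasPath H k ∧ edgeForm G x ≤ edgeForm H x := by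
  classical
  -- Since `x` may have ties, a strictly decreasing weight serves as potential: a graph of maximal
  -- `c`-form is nested, because an operation at a violation would raise that form strictly.
  let c : Fin n → ℝ := fun i => (n : ℝ) - i.val
  have hc0 : ∀ i, 0 ≤ c i := fun i => by
    have : (i.val : ℝ) ≤ n := by exact_mod_cast i.2.le
    simp only [c]; linarith
  have hcanti : ∀ i j, i < j → c j < c i := fun i j hij => by
    have : (i.val : ℝ) < j.val := by exact_mod_cast hij
    simp only [c]; linarith
  let F : Set (SimpleGraph (Fin n)) := {H | ¬ HasPath H k ∧ edgeForm G x ≤ edgeForm H x}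
  obtain ⟨H, hH, hmax⟩ := Set.exists_max_image F (fun H => edgeForm H c) (Set.toFinite F)
    ⟨G, hG, le_rfl⟩
  refine ⟨H, ?_, hH.1, hH.2⟩
  intro u v huv hadj b hbu hvb
  by_contra hub
  have h1 := edgeForm_kelmans H huv.ne x hx (hanti huv.le)
  have h2 := edgeForm_kelmans H huv.ne c hc0 (hcanti u v huv).le
  have h3 := h2.2 (hcanti u v huv) ⟨b, hbu, hvb, hub⟩
  exact (hmax (kelmans H u v) ⟨fun h => hH.1 (hasPath_of_hasPath_kelmans hadj h),
    hH.2.trans h1.1⟩).not_gt h3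

/-! ### Arithmetic of path lengths and levels -/

/-- `M` is a multiset of path lengths and `L r` a number of vertices of level less than `r`. For
every threshold `h` that separates the parts `A` and `B` of `M`, the number of vertices of small
level is at least the total of `B` plus a term that depends on the size of `A`. -/
structure LevelProfile (M : Multiset ℕ) (L : ℕ → ℕ) : Prop where
  mono : Monotone L
  zero : L 0 = 0
  le_sum : ∀ r, L r ≤ M.sum
  grow : ∀ r, L r = M.sum ∨ L r < L (r + 1)
  cut : ∀ A B : Multiset ℕ, ∀ h, M = A + B → 1 ≤ h → (∀ a ∈ A, h ≤ a) → (∀ b ∈ B, b ≤ h) →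
    (∃ r, h ≤ r ∧ 2 * r + A.card + B.sum ≤ L r + 2) ∨
      min A.card 2 * h + A.card + B.sum ≤ L h + min A.card 2

namespace LevelProfile

theorem empty : LevelProfile 0 (fun _ => 0) where
  mono := fun _ _ _ => le_rfl
  zero := rfl
  le_sum := by simp
  grow := by simp
  cut := by
    intro A B h hM _ _ _
    obtain ⟨rfl, rfl⟩ := add_eq_zero.1 hM.symm
    simp

theorem min_le {M : Multiset ℕ} {L : ℕ → ℕ} (P : LevelProfile M L) (r d : ℕ) :
    min M.sum (L r + d) ≤ L (r + d) := by
  induction d with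
  | zero => simp
  | succ d ih =>
    have h1 := P.grow (r + d)
    have h2 : L (r + d) ≤ L (r + (d + 1)) := P.mono (by omega)
    rw [show r + d + 1 = r + (d + 1) by ring] at h1
    omega

theorem cons_zero {M : Multiset ℕ} {L : ℕ → ℕ} (P : LevelProfile M L) :
    LevelProfile (0 ::ₘ M) L where
  mono := P.mono
  zero := P.zero
  le_sum := by simpa using P.le_sum
  grow := by simpa using P.grow
  cut := by
    intro A B h hM hh hA hB
    have h0 : 0 ∈ B := by
      have : 0 ∈ A + B := by rw [← hM]; simp
      rcases Multiset.mem_add.1 this with h1 | h1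
      · have := hA 0 h1; omega
      · exact h1
    obtain ⟨B', rfl⟩ := Multiset.exists_cons_of_mem h0
    rw [Multiset.add_cons] at hM
    have := P.cut A B' h ((Multiset.cons_inj_right _).1 hM) hh hA
      (fun b hb => hB b (Multiset.mem_cons_of_mem hb))
    simpa using this

theorem add {M₁ M₂ : Multiset ℕ} {L₁ L₂ : ℕ → ℕ} (P₁ : LevelProfile M₁ L₁)
    (P₂ : LevelProfile M₂ L₂) : LevelProfile (M₁ + M₂) (fun r => L₁ r + L₂ r) where
  mono := fun a b hab => Nat.add_le_add (P₁.mono hab) (P₂.mono hab)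
  zero := by simp [P₁.zero, P₂.zero]
  le_sum := fun r => by
    rw [Multiset.sum_add]
    exact Nat.add_le_add (P₁.le_sum r) (P₂.le_sum r)
  grow := fun r => by
    rw [Multiset.sum_add]
    have h1 := P₁.grow r
    have h2 := P₂.grow r
    have h3 := P₁.mono (Nat.le_succ r)
    have h4 := P₂.mono (Nat.le_succ r)
    simp only [Nat.succ_eq_add_one] at h3 h4
    omega
  cut := by
    intro A B h hM hh hA hB
    obtain ⟨A₁, B₁, A₂, B₂, rfl, rfl, rfl, rfl⟩ : ∃ A₁ B₁ A₂ B₂ : Multiset ℕ,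
        M₁ = A₁ + B₁ ∧ M₂ = A₂ + B₂ ∧ A = A₁ + A₂ ∧ B = B₁ + B₂ := by
      refine ⟨M₁ ∩ A, M₁ - M₁ ∩ A, A - M₁ ∩ A, B - (M₁ - M₁ ∩ A), ?_, ?_, ?_, ?_⟩ <;>
      · ext c
        have := congrArg (Multiset.count c) hM
        simp only [Multiset.count_add, Multiset.count_sub, Multiset.count_inter] at this ⊢
        omega
    simp only [Multiset.mem_add] at hA hB
    have c₁ := P₁.cut A₁ B₁ h rfl hh (fun a ha => hA a (Or.inl ha)) (fun b hb => hB b (Or.inl hb))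
    have c₂ := P₂.cut A₂ B₂ h rfl hh (fun a ha => hA a (Or.inr ha)) (fun b hb => hB b (Or.inr hb))
    have weak : ∀ (m c : ℕ), c = min m 2 → c ≤ c * h := fun m c _ => Nat.le_mul_of_pos_right _ hh
    simp only [Multiset.card_add, Multiset.sum_add]
    rcases c₁ with ⟨r₁, hr₁, c₁⟩ | c₁ <;> rcases c₂ with ⟨r₂, hr₂, c₂⟩ | c₂
    · left
      rcases le_total r₁ r₂ with hr | hr
      · have := P₁.mono hr
        exact ⟨r₂, hr₂, by omega⟩
      · have := P₂.mono hr
        exact ⟨r₁, hr₁, by omega⟩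
    · left
      have := P₂.mono hr₁
      have := weak _ _ (rfl : min A₂.card 2 = _)
      exact ⟨r₁, hr₁, by omega⟩
    · left
      have := P₁.mono hr₂
      have := weak _ _ (rfl : min A₁.card 2 = _)
      exact ⟨r₂, hr₂, by omega⟩
    · right
      obtain ⟨d, rfl⟩ := Nat.exists_eq_add_of_le hh
      have : min (A₁.card + A₂.card) 2 * d ≤ min A₁.card 2 * d + min A₂.card 2 * d := by
        rw [← Nat.add_mul]
        exact Nat.mul_le_mul_right _ (by omega)
      rw [Nat.mul_add] at c₁ c₂ ⊢
      omega

/-- Joining two long paths lowers `A.card` by one, and the root adds one to the count while shifting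
levels by one. These changes balance exactly in `2 * r + A.card + B.sum ≤ L r + 2` when `r` becomes
`r + 1`; this is why `cut` allows any `r ≥ h`. -/
theorem root {a b : ℕ} {R : Multiset ℕ} {L : ℕ → ℕ} (P : LevelProfile (a ::ₘ b ::ₘ R) L)
    (hba : b ≤ a) (hR : ∀ c ∈ R, c ≤ b) :
    LevelProfile ((1 + a + b) ::ₘ R) (fun r => if r = 0 then 0 else 1 + L (r - 1)) := by
  have hmono : Monotone (fun r => if r = 0 then 0 else 1 + L (r - 1)) := by
    intro r s hrs
    simp only
    split_ifs with h1 h2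
    · rfl
    · omega
    · omega
    · have := P.mono (show r - 1 ≤ s - 1 by omega)
      omega
  have hgrow : ∀ r, (if r = 0 then 0 else 1 + L (r - 1)) = ((1 + a + b) ::ₘ R).sum ∨
      (if r = 0 then 0 else 1 + L (r - 1)) < (if r + 1 = 0 then 0 else 1 + L (r + 1 - 1)) := by
    intro r
    rcases r with _ | r
    · right; simp
    · have := P.grow r
      simp only [Multiset.sum_cons] at this ⊢
      simp
      omega
  refine ⟨hmono, by simp, fun r => ?_, hgrow, ?_⟩
  · have := P.le_sum (r - 1)
    simp only [Multiset.sum_cons] at this ⊢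
    split_ifs <;> omega
  intro A B h hM hh hA hB
  have hmem : 1 + a + b ∈ A + B := by rw [← hM]; simp
  have hsucc : (if h = 0 then 0 else 1 + L (h - 1)) = 1 + L (h - 1) := if_neg (by omega)
  rcases Multiset.mem_add.1 hmem with hm | hm
  · obtain ⟨A', rfl⟩ := Multiset.exists_cons_of_mem hm
    rw [Multiset.cons_add, Multiset.cons_inj_right] at hM
    subst hM
    by_cases hhb : h ≤ b
    · left
      have c := P.cut (a ::ₘ b ::ₘ A') B h (by simp) hh
        (by
          intro c hc
          simp only [Multiset.mem_cons] at hc hA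
          rcases hc with rfl | rfl | hc
          · omega
          · exact hhb
          · exact hA c (Or.inr hc)) hB
      simp only [Multiset.card_cons] at c ⊢
      rcases c with ⟨r, hr, c⟩ | c
      · exact ⟨r + 1, by omega, by simp; omega⟩
      · rw [show min (A'.card + 1 + 1) 2 = 2 by omega] at c
        exact ⟨h + 1, by omega, by simp; omega⟩
    · have hA' : A' = 0 := by
        rw [Multiset.eq_zero_iff_forall_notMem]
        intro c hc
        have h1 := hR c (by simp [hc])
        have h2 := hA c (by simp [hc])
        omega
      subst hA'
      have hhA := hA (1 + a + b) (by simp)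
      simp only [zero_add] at hR P hgrow
      have hmin : ∀ r d, min (a + (b + B.sum)) (L r + d) ≤ L (r + d) := by
        simpa using P.min_le
      rcases Nat.eq_zero_or_pos b with rfl | hb
      · have hBs : B.sum = 0 := by
          rw [Multiset.sum_eq_zero_iff]
          intro c hc
          have := hR c hc
          omega
        right
        have := hmin 0 (h - 1)
        simp only [Multiset.card_cons, Multiset.card_zero, hsucc, zero_add, P.zero,
          show min 1 2 = 1 from rfl] at this ⊢
        omega
      -- Only the joined path reaches `h`, so the old profile is cut at `b`. If `h` lies beyond the
      -- level found, strict growth of `L` covers the distance.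
      · have c := P.cut (a ::ₘ b ::ₘ 0) B b (by simp) hb (by simpa using hba) hR
        obtain ⟨r, hr, c⟩ : ∃ r, b ≤ r ∧ 2 * r + B.sum ≤ L r := by
          simp only [Multiset.card_cons, Multiset.card_zero, show min (0 + 1 + 1) 2 = 2 from rfl] at c
          rcases c with ⟨r, hr, c⟩ | c
          · exact ⟨r, hr, by omega⟩
          · exact ⟨b, le_rfl, by omega⟩
        by_cases hrh : h ≤ r + 1
        · left
          exact ⟨r + 1, hrh, by simp; omega⟩
        · right
          have := hmin r (h - 1 - r)
          rw [show r + (h - 1 - r) = h - 1 by omega] at this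
          simp only [Multiset.card_cons, Multiset.card_zero, hsucc, show min (0 + 1) 2 = 1 from rfl]
          omega
  · have hh' := hB _ hm
    have hA0 : A = 0 := by
      rw [Multiset.eq_zero_iff_forall_notMem]
      intro c hc
      have h2 := hA c hc
      have : c ∈ (1 + a + b) ::ₘ R := by rw [hM]; simp [hc]
      rcases Multiset.mem_cons.1 this with rfl | h3
      · have h4 := Multiset.exists_cons_of_mem hm
        obtain ⟨B', rfl⟩ := h4
        obtain ⟨A', rfl⟩ := Multiset.exists_cons_of_mem hc
        rw [Multiset.cons_add, Multiset.cons_inj_right] at hM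
        have := hR (1 + a + b) (by rw [hM]; simp)
        omega
      · have := hR c h3
        omega
    subst hA0
    rw [zero_add] at hM
    subst hM
    right
    -- No length exceeds `a`, so a cut at `a` with empty upper part puts every old vertex at a level
    -- below `a ≤ h - 1`.
    have hsum : a + (b + R.sum) ≤ L (h - 1) := by
      rcases Nat.eq_zero_or_pos a with rfl | ha
      · have hRs : R.sum = 0 := by
          rw [Multiset.sum_eq_zero_iff]
          intro c hc
          have := hR c hc
          omega
        omega
      · have c := P.cut 0 (a ::ₘ b ::ₘ R) a (by simp) ha (by simp) (by
          intro c hc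
          simp only [Multiset.mem_cons] at hc
          rcases hc with rfl | rfl | hc
          · exact le_rfl
          · exact hba
          · exact (hR c hc).trans hba)
        have hle : ∀ r, L r ≤ a + (b + R.sum) := by simpa using P.le_sum
        simp only [Multiset.card_zero, Multiset.sum_cons] at c
        rcases c with ⟨r, hr, c⟩ | c
        · have h1 := hle r
          have h2 := P.mono (show r ≤ h - 1 by omega)
          omega
        · have h2 := P.mono (show a ≤ h - 1 by omega)
          omega
    simp only [Multiset.card_zero, hsucc, Multiset.sum_cons, show min 0 2 = 0 from rfl]
    omega

/-- If the two largest of the path lengths do not cover everything, few vertices under a common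
root have large level. -/
theorem exists_level {a b : ℕ} {R : Multiset ℕ} {L : ℕ → ℕ} (P : LevelProfile (a ::ₘ b ::ₘ R) L)
    (hba : b ≤ a) (hR : ∀ c ∈ R, c ≤ b) (hpos : 0 < R.sum) :
    ∃ r, 1 ≤ r ∧ 2 * r + R.sum ≤ L r := by
  have hb : 0 < b := by
    rcases Nat.eq_zero_or_pos b with rfl | hb
    · have : R.sum = 0 := by
        rw [Multiset.sum_eq_zero_iff]
        intro c hc
        have := hR c hc
        omega
      omega
    · exact hb
  have c := P.cut (a ::ₘ b ::ₘ 0) R b (by simp) hb (by simpa using hba) hR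
  simp only [Multiset.card_cons, Multiset.card_zero, show min (0 + 1 + 1) 2 = 2 from rfl] at c
  rcases c with ⟨r, hr, c⟩ | c
  · exact ⟨r, by omega, by omega⟩
  · exact ⟨b, hb, by omega⟩

end LevelProfile

/-! ### Path partitions -/

theorem Multiset.exists_cons_max {α : Type*} (f : α → ℕ) {Q : Multiset α} (hQ : Q ≠ 0) :
    ∃ p Q', Q = p ::ₘ Q' ∧ ∀ q ∈ Q', f q ≤ f p := by
  classical
  obtain ⟨a, ha⟩ := Multiset.exists_mem_of_ne_zero hQ
  obtain ⟨p, hp, hmax⟩ := Q.toFinset.exists_max_image f ⟨a, by simpa using ha⟩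
  rw [Multiset.mem_toFinset] at hp
  obtain ⟨Q', rfl⟩ := Multiset.exists_cons_of_mem hp
  exact ⟨p, Q', rfl, fun q hq => hmax q (by simp [hq])⟩

section
variable {V : Type*}

/-- A family of paths of `G` that partitions `S`. Empty paths are allowed. -/
structure IsPathPartition (G : SimpleGraph V) (S : Finset V) (Q : Multiset (List V)) : Prop where
  chain : ∀ p ∈ Q, p.IsChain G.Adj
  sum_eq : (Q.map (fun p : List V => (p : Multiset V))).sum = S.val

theorem IsPathPartition.nodup {G : SimpleGraph V} {S : Finset V} {Q : Multiset (List V)}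
    (hQ : IsPathPartition G S Q) {p : List V} (hp : p ∈ Q) : p.Nodup := by
  rw [← Multiset.coe_nodup]
  refine Multiset.nodup_of_le ?_ S.nodup
  rw [← hQ.sum_eq]
  exact Multiset.le_sum_of_mem (Multiset.mem_map_of_mem _ hp)

theorem IsPathPartition.sum_length {G : SimpleGraph V} {S : Finset V} {Q : Multiset (List V)}
    (hQ : IsPathPartition G S Q) : (Q.map List.length).sum = #S := by
  rw [Finset.card_def, ← hQ.sum_eq, ← Multiset.cardHom_apply, map_multiset_sum, Multiset.map_map]
  rfl

theorem IsPathPartition.mem {G : SimpleGraph V} {S : Finset V} {Q : Multiset (List V)}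
    (hQ : IsPathPartition G S Q) {p : List V} (hp : p ∈ Q) {w : V} (hw : w ∈ p) : w ∈ S := by
  rw [← Finset.mem_val, ← hQ.sum_eq]
  exact Multiset.mem_of_le (Multiset.le_sum_of_mem (Multiset.mem_map_of_mem _ hp)) hw

theorem IsPathPartition.cons_nil {G : SimpleGraph V} {S : Finset V} {Q : Multiset (List V)}
    (hQ : IsPathPartition G S Q) : IsPathPartition G S ([] ::ₘ Q) :=
  ⟨by simpa using hQ.chain, by simpa using hQ.sum_eq⟩

/-- A path partition with a level profile can be padded so that its two largest paths split off. -/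
theorem exists_two_longest {G : SimpleGraph V} {S : Finset V} {L : ℕ → ℕ}
    (h : ∃ Q, IsPathPartition G S Q ∧ LevelProfile (Q.map List.length) L) :
    ∃ p q Q, IsPathPartition G S (p ::ₘ q ::ₘ Q) ∧
      LevelProfile (p.length ::ₘ q.length ::ₘ Q.map List.length) L ∧
      q.length ≤ p.length ∧ ∀ c ∈ Q.map List.length, c ≤ q.length := by
  obtain ⟨Q, h1, h2⟩ := h
  -- Two empty paths ensure that two paths can be split off, even from an empty partition.
  have h1' := h1.cons_nil.cons_nil
  have h2' : LevelProfile (([] ::ₘ [] ::ₘ Q).map List.length) L := by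
    simpa using h2.cons_zero.cons_zero
  have hcard : 2 ≤ ([] ::ₘ [] ::ₘ Q).card := by simp
  generalize ([] ::ₘ [] ::ₘ Q) = Q₀ at h1' h2' hcard
  obtain ⟨p, Q₁, rfl, hp⟩ := Multiset.exists_cons_max List.length
    (Q := Q₀) (by rintro rfl; simp at hcard)
  obtain ⟨q, Q₂, rfl, hq⟩ := Multiset.exists_cons_max List.length
    (Q := Q₁) (by rintro rfl; simp at hcard)
  refine ⟨p, q, Q₂, h1', by simpa using h2', hp q (by simp), ?_⟩
  intro c hc
  obtain ⟨r, hr, rfl⟩ := Multiset.mem_map.1 hc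
  exact hq r hr

end

/-! ### Levels in nested graphs -/

section
variable {V : Type*} [LinearOrder V]

open Classical in
/-- The neighbours of `w` in `S` that come before `w`. -/
noncomputable def priorNeighbors (G : SimpleGraph V) (S : Finset V) (w : V) : Finset V :=
  {v ∈ S | v < w ∧ G.Adj v w}

/-- The number of vertices of `S` with fewer than `r` prior neighbours in `S`. -/
noncomputable def levelCount (G : SimpleGraph V) (S : Finset V) (r : ℕ) : ℕ :=
  #{w ∈ S | #(priorNeighbors G S w) < r}

theorem priorNeighbors_union_left {G : SimpleGraph V} {S T : Finset V}
    (h : ∀ v ∈ S, ∀ w ∈ T, ¬ G.Adj v w) {w : V} (hw : w ∈ S) :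
    priorNeighbors G (S ∪ T) w = priorNeighbors G S w := by
  ext v
  simp only [priorNeighbors, mem_filter, mem_union]
  constructor
  · rintro ⟨h1 | h1, h2, h3⟩
    · exact ⟨h1, h2, h3⟩
    · exact absurd h3.symm (h w hw v h1)
  · rintro ⟨h1, h2⟩
    exact ⟨Or.inl h1, h2⟩

theorem levelCount_union {G : SimpleGraph V} {S T : Finset V} (hd : Disjoint S T)
    (h : ∀ v ∈ S, ∀ w ∈ T, ¬ G.Adj v w) (r : ℕ) :
    levelCount G (S ∪ T) r = levelCount G S r + levelCount G T r := by
  unfold levelCount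
  rw [filter_union, card_union_of_disjoint (disjoint_filter_filter hd)]
  congr 2
  · exact filter_congr fun w hw => by rw [priorNeighbors_union_left h hw]
  · refine filter_congr fun w hw => ?_
    rw [union_comm, priorNeighbors_union_left (fun v hv w hw h' => h w hw v hv h'.symm) hw]

/-- `u` precedes and is adjacent to every vertex of `F`. -/
def IsRootOf (G : SimpleGraph V) (u : V) (F : Finset V) : Prop :=
  ∀ w ∈ F, u < w ∧ G.Adj u w

theorem IsRootOf.notMem {G : SimpleGraph V} {u : V} {F : Finset V} (h : IsRootOf G u F) : u ∉ F :=
  fun hu => lt_irrefl _ (h u hu).1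

theorem priorNeighbors_insert_root {G : SimpleGraph V} {u : V} {F : Finset V}
    (h : IsRootOf G u F) : priorNeighbors G (insert u F) u = ∅ := by
  ext v
  simp only [priorNeighbors, mem_filter, mem_insert, notMem_empty, iff_false]
  rintro ⟨rfl | h1, h2, h3⟩
  · exact lt_irrefl _ h2
  · exact lt_asymm h2 (h v h1).1

theorem card_priorNeighbors_insert {G : SimpleGraph V} {u : V} {F : Finset V}
    (h : IsRootOf G u F) {w : V} (hw : w ∈ F) :
    #(priorNeighbors G (insert u F) w) = #(priorNeighbors G F w) + 1 := by
  have : priorNeighbors G (insert u F) w = insert u (priorNeighbors G F w) := by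
    ext v
    simp only [priorNeighbors, mem_filter, mem_insert]
    constructor
    · rintro ⟨rfl | h1, h2⟩
      · exact Or.inl rfl
      · exact Or.inr ⟨h1, h2⟩
    · rintro (rfl | ⟨h1, h2⟩)
      · exact ⟨Or.inl rfl, h w hw⟩
      · exact ⟨Or.inr h1, h2⟩
  rw [this, card_insert_of_notMem]
  simp [priorNeighbors, h.notMem]

theorem levelCount_insert {G : SimpleGraph V} {u : V} {F : Finset V}
    (h : IsRootOf G u F) (r : ℕ) :
    levelCount G (insert u F) r = if r = 0 then 0 else 1 + levelCount G F (r - 1) := by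
  unfold levelCount
  split_ifs with hr
  · subst hr; simp
  · rw [filter_insert, priorNeighbors_insert_root h, card_empty, if_pos (by omega),
      card_insert_of_notMem (by simp [h.notMem]), add_comm]
    congr 2
    refine filter_congr fun w hw => ?_
    rw [card_priorNeighbors_insert h hw]
    omega

/-- Decompose `S` as the closed neighbourhood of its first vertex and a rest that is not joined
to it. -/
theorem IsNested.exists_root {G : SimpleGraph V} (hG : IsNested G) {S : Finset V}
    (hS : S.Nonempty) : ∃ (u : V) (F R : Finset V), IsRootOf G u F ∧ S = insert u F ∪ R ∧
      Disjoint (insert u F) R ∧ ∀ v ∈ insert u F, ∀ w ∈ R, ¬ G.Adj v w := by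
  classical
  have hmem := S.min'_mem hS
  have hmin : ∀ w ∈ S, w ≠ S.min' hS → S.min' hS < w := fun w hw hne =>
    lt_of_le_of_ne (S.min'_le w hw) hne.symm
  set u := S.min' hS
  refine ⟨u, {w ∈ S | G.Adj u w}, {w ∈ S | w ≠ u ∧ ¬ G.Adj u w}, ?_, ?_, ?_, ?_⟩
  · intro w hw
    rw [mem_filter] at hw
    exact ⟨hmin w hw.1 hw.2.ne.symm, hw.2⟩
  · ext w
    simp only [mem_union, mem_insert, mem_filter]
    by_cases h1 : w = u
    · simp [h1, hmem]
    · tauto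
  · rw [Finset.disjoint_left]
    intro w hw hw'
    simp only [mem_insert, mem_filter] at hw hw'
    tauto
  · intro v hv w hw hvw
    simp only [mem_insert, mem_filter] at hv hw
    rcases hv with rfl | ⟨hv, huv⟩
    · exact hw.2.2 hvw
    · exact hw.2.2 (hG u v (hmin v hv huv.ne.symm) huv w hw.2.1 hvw)

/-- Two paths of a partition under a root are joined through the root. -/
theorem IsPathPartition.join {G : SimpleGraph V} {u : V} {F : Finset V} (hu : IsRootOf G u F)
    {p q : List V} {Q : Multiset (List V)} (h : IsPathPartition G F (p ::ₘ q ::ₘ Q)) :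
    IsPathPartition G (insert u F) ((p.reverse ++ u :: q) ::ₘ Q) := by
  constructor
  · intro l hl
    rcases Multiset.mem_cons.1 hl with rfl | hl
    · rw [List.isChain_reverse_append_cons_iff (fun _ _ h => h.symm)]
      refine ⟨h.chain p (by simp), h.chain q (by simp), fun z hz => ?_, fun z hz => ?_⟩
      · exact (hu z (h.mem (by simp) (List.mem_of_mem_head? hz))).2
      · exact (hu z (h.mem (p := q) (by simp) (List.mem_of_mem_head? hz))).2
    · exact h.chain l (by simp [hl])
  · rw [Finset.insert_val_of_notMem hu.notMem, ← h.sum_eq]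
    simp only [Multiset.map_cons, Multiset.sum_cons, ← Multiset.coe_add, ← Multiset.cons_coe,
      Multiset.coe_reverse, Multiset.add_cons, Multiset.cons_add, add_assoc]

/-- The greedy partition: the two longest paths below the first vertex are joined through it
(`LevelProfile.root`), and the part not joined to it is treated separately (`LevelProfile.add`). -/
theorem IsNested.exists_pathPartition {G : SimpleGraph V} (hG : IsNested G) (S : Finset V) :
    ∃ Q, IsPathPartition G S Q ∧ LevelProfile (Q.map List.length) (levelCount G S) := by
  induction hm : #S using Nat.strong_induction_on generalizing S with
  | _ m ih =>
  rcases S.eq_empty_or_nonempty with rfl | hS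
  · refine ⟨0, ⟨by simp, by simp⟩, ?_⟩
    have : levelCount G (∅ : Finset V) = fun _ => 0 := by
      ext r; simp [levelCount]
    rw [this]
    exact LevelProfile.empty
  · obtain ⟨u, F, R, hu, rfl, hd, hno⟩ := hG.exists_root hS
    have hcard : #F + 1 + #R = m := by
      rw [← hm, card_union_of_disjoint hd, card_insert_of_notMem hu.notMem]
    obtain ⟨p, q, Q, h1, h2, h3, h4⟩ := exists_two_longest (ih #F (by omega) F rfl)
    obtain ⟨Q', h5, h6⟩ := ih #R (by omega) R rfl
    refine ⟨((p.reverse ++ u :: q) ::ₘ Q) + Q', ⟨?_, ?_⟩, ?_⟩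
    · intro l hl
      rcases Multiset.mem_add.1 hl with hl | hl
      · exact (h1.join hu).chain l hl
      · exact h5.chain l hl
    · rw [Multiset.map_add, Multiset.sum_add, (h1.join hu).sum_eq, h5.sum_eq,
        ← Finset.disjUnion_eq_union _ _ hd]
      rfl
    · have h7 := (h2.root h3 h4).add h6
      have e1 : levelCount G (insert u F ∪ R) = fun r =>
          (if r = 0 then 0 else 1 + levelCount G F (r - 1)) + levelCount G R r := by
        ext r
        rw [levelCount_union hd hno, levelCount_insert hu]
      rw [e1, Multiset.map_add, Multiset.map_cons]
      convert h7 using 3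
      simp
      omega

theorem levelCount_add_card {G : SimpleGraph V} (S : Finset V) (r : ℕ) :
    levelCount G S r + #{w ∈ S | r ≤ #(priorNeighbors G S w)} = #S := by
  simp_rw [levelCount, ← not_lt]
  exact Finset.card_filter_add_card_filter_not _

/-- In a rooted piece with at least `k` vertices and without a path on `k` vertices, few vertices
have many prior neighbours. -/
theorem IsNested.exists_level {G : SimpleGraph V} (hG : IsNested G) {k : ℕ} (hk : ¬ HasPath G k)
    {u : V} {F : Finset V} (hu : IsRootOf G u F) (hF : k ≤ #F + 1) :
    ∃ s, 1 ≤ s ∧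
      #{w ∈ insert u F | s + 1 ≤ #(priorNeighbors G (insert u F) w)} + 2 * s + 2 ≤ k := by
  obtain ⟨p, q, Q, h1, h2, h3, h4⟩ := exists_two_longest (hG.exists_pathPartition F)
  have hlen : p.length + 1 + q.length < k := by
    by_contra hcon
    have hmem : p.reverse ++ u :: q ∈ (p.reverse ++ u :: q) ::ₘ Q := Multiset.mem_cons_self _ _
    refine hk ⟨p.reverse ++ u :: q, (h1.join hu).nodup hmem, (h1.join hu).chain _ hmem, ?_⟩
    simp
    omega
  have hsum := h1.sum_length
  simp only [Multiset.map_cons, Multiset.sum_cons] at hsum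
  -- The leftover length is positive because `#F ≥ k - 1`, while the two longest paths cover at most
  -- `k - 2` vertices.
  obtain ⟨s, hs, hs'⟩ := h2.exists_level h3 h4 (by omega)
  have e1 := levelCount_add_card (G := G) F s
  have e2 := levelCount_add_card (G := G) (insert u F) (s + 1)
  rw [levelCount_insert hu, card_insert_of_notMem hu.notMem, if_neg (by omega)] at e2
  simp only [Nat.add_sub_cancel] at e2
  exact ⟨s, hs, by omega⟩

/-- The number of vertices with many prior neighbours decreases strictly until it vanishes. -/
theorem IsNested.card_level_le {G : SimpleGraph V} (hG : IsNested G) (S : Finset V) (r d : ℕ) :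
    #{w ∈ S | r + d ≤ #(priorNeighbors G S w)} ≤ #{w ∈ S | r ≤ #(priorNeighbors G S w)} - d := by
  obtain ⟨Q, h1, h2⟩ := hG.exists_pathPartition S
  have h3 := h2.min_le r d
  rw [h1.sum_length] at h3
  have e1 := levelCount_add_card (G := G) S r
  have e2 := levelCount_add_card (G := G) S (r + d)
  omega

end

/-! ### Comparison with the extremal candidates -/

/-- The edge form of the subgraph induced on `S`, every edge being counted once. -/
noncomputable def edgeFormOn {V : Type*} [LinearOrder V] (G : SimpleGraph V) (S : Finset V)
    (x : V → ℝ) : ℝ :=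
  ∑ w ∈ S, ∑ v ∈ priorNeighbors G S w, (x v + x w) ^ 2

theorem edgeForm_eq_two_mul {V : Type*} [Fintype V] [LinearOrder V] (G : SimpleGraph V)
    (x : V → ℝ) : edgeForm G x = 2 * edgeFormOn G Finset.univ x := by
  classical
  have h1 : edgeFormOn G Finset.univ x =
      ∑ w, ∑ v, if v < w ∧ G.Adj v w then (x v + x w) ^ 2 else 0 := by
    simp only [edgeFormOn, priorNeighbors, sum_filter]
  have h2 : edgeFormOn G Finset.univ x =
      ∑ w, ∑ v, if w < v ∧ G.Adj w v then (x w + x v) ^ 2 else 0 := by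
    rw [h1, sum_comm]
  rw [two_mul]
  nth_rw 1 [h1]
  rw [h2, edgeForm, ← sum_add_distrib]
  refine sum_congr rfl fun w _ => ?_
  rw [← sum_add_distrib]
  refine sum_congr rfl fun v _ => ?_
  rw [G.adj_comm v w, add_comm (x v)]
  by_cases h : G.Adj w v
  · rcases lt_or_gt_of_ne h.ne with h' | h'
    · simp [h, h', h'.not_gt]
    · simp [h, h', h'.not_gt]
  · simp [h]

theorem edgeFormOn_union {V : Type*} [LinearOrder V] {G : SimpleGraph V} {S T : Finset V}
    (hd : Disjoint S T) (h : ∀ v ∈ S, ∀ w ∈ T, ¬ G.Adj v w) (x : V → ℝ) :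
    edgeFormOn G (S ∪ T) x = edgeFormOn G S x + edgeFormOn G T x := by
  unfold edgeFormOn
  rw [sum_union hd]
  congr 1
  · exact sum_congr rfl fun w hw => by rw [priorNeighbors_union_left h hw]
  · refine sum_congr rfl fun w hw => ?_
    rw [union_comm, priorNeighbors_union_left (fun v hv w hw h' => h w hw v hv h'.symm) hw]

theorem edgeForm_fin {N : ℕ} (H : SimpleGraph (Fin N)) (R : ℕ → ℕ → Prop) [DecidableRel R]
    (hR : ∀ i j : Fin N, i < j → (H.Adj i j ↔ R i j)) (y : ℕ → ℝ) :
    edgeForm H (fun i => y i) = 2 * ∑ p ∈ range N, ∑ i ∈ range p with R i p, (y i + y p) ^ 2 := by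
  rw [edgeForm_eq_two_mul, edgeFormOn, sum_range]
  congr 1
  refine sum_congr rfl fun w _ => ?_
  refine sum_nbij (fun v => v.val) ?_ ?_ ?_ ?_
  · intro v hv
    simp only [priorNeighbors, mem_filter, mem_univ, true_and, mem_range] at hv ⊢
    exact ⟨hv.1, (hR v w hv.1).1 hv.2⟩
  · exact Fin.val_injective.injOn
  · intro i hi
    simp only [coe_filter, mem_range, Set.mem_ofPred_eq] at hi
    refine ⟨⟨i, hi.1.trans w.2⟩, ?_, rfl⟩
    simp only [priorNeighbors, mem_coe, mem_filter, mem_univ, true_and]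
    exact ⟨hi.1, (hR ⟨i, hi.1.trans w.2⟩ w hi.1).2 hi.2⟩
  · intro v _
    rfl

/-- A sum of values of an antitone function is largest over an initial segment. -/
theorem sum_le_sum_Ico_of_antitone {f : ℕ → ℝ} (hf : Antitone f) (h0 : ∀ i, 0 ≤ f i)
    {A : Finset ℕ} {a c : ℕ} (ha : ∀ p ∈ A, a ≤ p) (hc : #A ≤ c) :
    ∑ p ∈ A, f p ≤ ∑ p ∈ Ico a (a + c), f p := by
  rw [← sum_inter_add_sum_sdiff A (Ico a (a + c)), ← sum_inter_add_sum_sdiff (Ico a (a + c)) A]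
  refine add_le_add (by rw [inter_comm]) ?_
  have h1 : #(A \ Ico a (a + c)) ≤ #(Ico a (a + c) \ A) := by
    have e1 := card_inter_add_card_sdiff A (Ico a (a + c))
    have e2 := card_inter_add_card_sdiff (Ico a (a + c)) A
    rw [inter_comm] at e2
    rw [Nat.card_Ico] at e2
    omega
  calc ∑ p ∈ A \ Ico a (a + c), f p ≤ #(A \ Ico a (a + c)) • f (a + c) := by
        refine sum_le_card_nsmul _ _ _ fun p hp => hf ?_
        simp only [mem_sdiff, mem_Ico] at hp
        have := ha p hp.1
        omega
    _ ≤ #(Ico a (a + c) \ A) • f (a + c) := nsmul_le_nsmul_left (h0 _) h1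
    _ ≤ _ := by
        refine card_nsmul_le_sum _ f _ fun p hp => hf ?_
        simp only [mem_sdiff, mem_Ico] at hp
        omega

theorem antitone_add_sq {y : ℕ → ℝ} (hy : Antitone y) (h0 : ∀ i, 0 ≤ y i) (c : ℝ) (hc : 0 ≤ c) :
    Antitone (fun i => (y i + c) ^ 2) := by
  intro i j hij
  have := hy hij
  have := h0 j
  simp only
  gcongr

/-- Replace the vertices of `T` by their positions in `T`, and prior neighbourhoods by initial
segments of the same size. -/
theorem exists_sorted {V : Type*} [LinearOrder V] (G : SimpleGraph V) (T : Finset V) {x : V → ℝ}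
    (hx : Antitone x) (h0 : ∀ i, 0 ≤ x i) :
    ∃ (y : ℕ → ℝ) (l : ℕ → ℕ), Antitone y ∧ (∀ p, 0 ≤ y p) ∧ (∀ p, #T ≤ p → y p = 0) ∧
      (∀ p, l p ≤ p) ∧
      (∀ r, #{p ∈ range #T | r ≤ l p} = #{w ∈ T | r ≤ #(priorNeighbors G T w)}) ∧
      ∑ p ∈ range #T, y p ^ 2 = ∑ w ∈ T, x w ^ 2 ∧
      edgeFormOn G T x ≤ ∑ p ∈ range #T, ∑ i ∈ range (l p), (y i + y p) ^ 2 := by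
  classical
  let e := T.orderEmbOfFin rfl
  let y : ℕ → ℝ := fun p => if h : p < #T then x (e ⟨p, h⟩) else 0
  let l : ℕ → ℕ := fun p => if h : p < #T then #(priorNeighbors G T (e ⟨p, h⟩)) else 0
  have hyv : ∀ p : Fin #T, y p = x (e p) := fun p => by simp [y]
  have hlv : ∀ p : Fin #T, l p = #(priorNeighbors G T (e p)) := fun p => by simp [l]
  have hsum : ∀ {M : Type} [AddCommMonoid M] (g : V → M),
      ∑ w ∈ T, g w = ∑ p : Fin #T, g (e p) := by
    intro M _ g
    have := sum_map Finset.univ e.toEmbedding g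
    rwa [Finset.map_orderEmbOfFin_univ] at this
  have hy0 : ∀ p, 0 ≤ y p := fun p => by
    simp only [y]; split_ifs <;> [exact h0 _; exact le_rfl]
  have hya : Antitone y := by
    intro p q hpq
    simp only [y]
    split_ifs with h1 h2
    · exact hx (e.monotone hpq)
    · omega
    · exact h0 _
    · exact le_rfl
  let pos : Fin #T → Finset ℕ := fun p =>
    (Finset.univ.filter fun i : Fin #T => i < p ∧ G.Adj (e i) (e p)).map Fin.valEmbedding
  have hprior : ∀ p : Fin #T, priorNeighbors G T (e p) =
      (Finset.univ.filter fun i : Fin #T => i < p ∧ G.Adj (e i) (e p)).map e.toEmbedding := by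
    intro p
    ext v
    simp only [priorNeighbors, mem_filter, mem_map, mem_univ, true_and]
    constructor
    · rintro ⟨hv, hlt, hadj⟩
      rw [← Finset.map_orderEmbOfFin_univ T rfl, mem_map] at hv
      obtain ⟨i, -, rfl⟩ := hv
      exact ⟨i, ⟨e.lt_iff_lt.1 hlt, hadj⟩, rfl⟩
    · rintro ⟨i, ⟨h1, h2⟩, rfl⟩
      exact ⟨Finset.orderEmbOfFin_mem T rfl i, e.lt_iff_lt.2 h1, h2⟩
  have hcard : ∀ p : Fin #T, #(pos p) = l p := fun p => by
    rw [hlv, hprior, card_map, card_map]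
  have hlp : ∀ p, l p ≤ p := by
    intro p
    by_cases h : p < #T
    · rw [← hcard ⟨p, h⟩]
      refine (card_le_card (t := range p) fun i hi => ?_).trans_eq (card_range p)
      simp only [pos, mem_map, mem_filter, mem_univ, true_and] at hi
      obtain ⟨i, ⟨h1, -⟩, rfl⟩ := hi
      exact mem_range.2 h1
    · simp [l, h]
  refine ⟨y, l, hya, hy0, fun p hp => by simp [y, hp.not_gt], hlp, fun r => ?_, ?_, ?_⟩
  · rw [card_filter, card_filter, hsum, sum_range]
    simp only [hlv]
  · rw [hsum, sum_range]
    simp only [hyv]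
  · rw [edgeFormOn, hsum, sum_range]
    refine sum_le_sum fun p _ => ?_
    rw [hprior, sum_map]
    have h1 : ∑ i ∈ pos p, (y i + y p) ^ 2 ≤ ∑ i ∈ Ico 0 (0 + l p), (y i + y p) ^ 2 :=
      sum_le_sum_Ico_of_antitone (antitone_add_sq hya hy0 _ (hy0 p)) (fun _ => sq_nonneg _)
        (fun _ _ => Nat.zero_le _) (hcard p).le
    rw [zero_add, Nat.Ico_zero_eq_range] at h1
    refine le_trans (le_of_eq ?_) h1
    simp only [pos, sum_map, Fin.valEmbedding_apply, hyv]
    rfl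

/-- Sum by the earlier end `i` instead. For `i < s` the right side contains every later `p`; for `i
≥ s` the at most `c - 1 - i` later ends weigh least when pushed back, and most when they fill `i +
1, …, c - 1`. -/
theorem sum_levels_le {y : ℕ → ℝ} (hy : Antitone y) (h0 : ∀ p, 0 ≤ y p) {l : ℕ → ℕ}
    (hl : ∀ p, l p ≤ p) {m n s c : ℕ} (hmn : m ≤ n) (hcn : c ≤ n)
    (hcount : ∀ i, s ≤ i → #{p ∈ range m | i + 1 ≤ l p} ≤ c - 1 - i) :
    ∑ p ∈ range m, ∑ i ∈ range (l p), (y i + y p) ^ 2 ≤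
      ∑ p ∈ range n, ∑ i ∈ range p with (i < s ∨ p < c), (y i + y p) ^ 2 := by
  have e1 : ∑ p ∈ range m, ∑ i ∈ range (l p), (y i + y p) ^ 2 =
      ∑ i ∈ range m, ∑ p ∈ range m with i + 1 ≤ l p, (y i + y p) ^ 2 := by
    refine sum_comm' fun p i => ?_
    simp only [mem_range, mem_filter]
    have := hl p
    omega
  have e2 : ∑ p ∈ range n, ∑ i ∈ range p with (i < s ∨ p < c), (y i + y p) ^ 2 =
      ∑ i ∈ range n, ∑ p ∈ range n with (i < p ∧ (i < s ∨ p < c)), (y i + y p) ^ 2 := by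
    refine sum_comm' fun p i => ?_
    simp only [mem_range, mem_filter]
    omega
  rw [e1, e2]
  refine le_trans (sum_le_sum fun i _ => ?_)
    (sum_le_sum_of_subset_of_nonneg (range_subset_range.2 hmn)
      fun i _ _ => sum_nonneg fun p _ => sq_nonneg _)
  by_cases his : i < s
  · refine sum_le_sum_of_subset_of_nonneg (fun p hp => ?_) fun p _ _ => sq_nonneg _
    simp only [mem_range, mem_filter] at hp ⊢
    have := hl p
    omega
  · have h1 : ∑ p ∈ range m with i + 1 ≤ l p, (y i + y p) ^ 2 ≤
        ∑ p ∈ Ico (i + 1) (i + 1 + (c - 1 - i)), (y i + y p) ^ 2 := by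
      refine sum_le_sum_Ico_of_antitone (f := fun p => (y i + y p) ^ 2) ?_
        (fun _ => sq_nonneg _) ?_ (hcount i (by omega))
      · simpa only [add_comm] using antitone_add_sq hy h0 (y i) (h0 i)
      · intro p hp
        simp only [mem_range, mem_filter] at hp
        have := hl p
        omega
    refine h1.trans (sum_le_sum_of_subset_of_nonneg (fun p hp => ?_) fun p _ _ => sq_nonneg _)
    simp only [mem_range, mem_filter, mem_Ico] at hp ⊢
    omega

theorem sum_fin_sq_eq {y : ℕ → ℝ} {m N : ℕ} (hmN : m ≤ N) (hy : ∀ p, m ≤ p → y p = 0) :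
    ∑ i : Fin N, y i ^ 2 = ∑ p ∈ range m, y p ^ 2 := by
  rw [← sum_range (fun p => y p ^ 2)]
  refine (sum_subset (range_subset_range.2 hmN) fun p _ hp => ?_).symm
  rw [hy p (by simpa using hp)]
  simp

/-- The form of a rooted piece of a nested graph without a path on `k` vertices is bounded by the
spectral radii of the extremal candidates. -/
theorem IsNested.edgeFormOn_le {n k : ℕ} {G : SimpleGraph (Fin n)}
    (hG : IsNested G) (hk : ¬ HasPath G k) {x : Fin n → ℝ} (hx : Antitone x) (h0 : ∀ i, 0 ≤ x i)
    {q : ℝ} (hW : ∀ s, 1 ≤ s → s ≤ k / 2 - 1 →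
      signlessLaplacianSpectralRadius (graphW n (k - 1) s) ≤ q)
    (hK : signlessLaplacianSpectralRadius (SimpleGraph.completeGraph (Fin (k - 1))) ≤ q)
    (S : Finset (Fin n)) : edgeFormOn G S x ≤ q * ∑ w ∈ S, x w ^ 2 := by
  classical
  induction hm : #S using Nat.strong_induction_on generalizing S with
  | _ m ih =>
  rcases S.eq_empty_or_nonempty with rfl | hS
  · simp [edgeFormOn]
  obtain ⟨u, F, R, hu, rfl, hd, hno⟩ := hG.exists_root hS
  rw [edgeFormOn_union hd hno, sum_union hd, mul_add]
  rw [card_union_of_disjoint hd, card_insert_of_notMem hu.notMem] at hm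
  refine add_le_add ?_ (ih #R (by omega) R rfl)
  obtain ⟨y, l, hy, hy0, hyz, hl, hcount, hsum, hform⟩ := exists_sorted G (insert u F) hx h0
  refine hform.trans ?_
  rw [← hsum]
  have hcardn : #(insert u F) ≤ n := by simpa using card_le_univ (insert u F)
  rcases lt_or_ge #(insert u F) k with hlt | hge
  · have h1 := edgeForm_fin (SimpleGraph.completeGraph (Fin (k - 1))) (fun _ _ => True)
      (fun i j hij => by simpa using hij.ne) y
    have h2 := edgeForm_le (SimpleGraph.completeGraph (Fin (k - 1))) (fun i => y i)
    rw [sum_fin_sq_eq (by omega) hyz] at h2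
    have h3 := mul_le_mul_of_nonneg_right hK
      (sum_nonneg fun p (_ : p ∈ range #(insert u F)) => sq_nonneg (y p))
    have h4 : ∑ p ∈ range #(insert u F), ∑ i ∈ range (l p), (y i + y p) ^ 2 ≤
        ∑ p ∈ range (k - 1), ∑ i ∈ range p with True, (y i + y p) ^ 2 := by
      refine le_trans (sum_le_sum fun p _ => ?_)
        (sum_le_sum_of_subset_of_nonneg (range_subset_range.2 (by omega))
          fun p _ _ => sum_nonneg fun i _ => sq_nonneg _)
      rw [filter_true]
      exact sum_le_sum_of_subset_of_nonneg (range_subset_range.2 (hl p)) fun _ _ _ => sq_nonneg _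
    linarith
  · obtain ⟨s, hs1, hs⟩ := hG.exists_level hk hu
      (by rw [card_insert_of_notMem hu.notMem] at hge; omega)
    have h1 := edgeForm_fin (graphW n (k - 1) s) (fun i p => i < s ∨ p < k - 1 - s)
      (fun i j hij => by
        have : i.val < j.val := hij
        simp only [graphW, ne_eq, Fin.ext_iff]
        omega) y
    have h2 := edgeForm_le (graphW n (k - 1) s) (fun i => y i)
    rw [sum_fin_sq_eq hcardn hyz] at h2
    have h3 := mul_le_mul_of_nonneg_right (hW s hs1 (by omega))
      (sum_nonneg fun p (_ : p ∈ range #(insert u F)) => sq_nonneg (y p))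
    -- At most `k - 2 - 2s` vertices have level at least `s + 1`; going up `i - s` further levels
    -- leaves at most `(k - 1 - s) - 1 - i`.
    have h4 := sum_levels_le hy hy0 hl (s := s) (c := k - 1 - s) hcardn (by omega) (by
      intro i hi
      rw [hcount]
      have := hG.card_level_le (insert u F) (s + 1) (i - s)
      rw [show s + 1 + (i - s) = i + 1 by omega] at this
      omega)
    linarith

/-! ### The candidates are free of long paths; conclusion -/

/-- On a path, each vertex of `Z`, and also the last one of `Y`, is followed by a vertex of `X`
unless it ends the path. So `#Z ≤ #X` if the path meets `Y`, giving at most `2s + (k - 1 - 2s)`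
vertices; otherwise there are at most `2s + 1 < k`. -/
theorem graphW_free {n k s : ℕ} (hs : 1 ≤ s) (hsk : s ≤ k / 2 - 1) :
    (SimpleGraph.pathGraph k).Free (graphW n (k - 1) s) := by
  rintro ⟨f⟩
  let g : ℕ → ℕ := fun i => if h : i < k then (f ⟨i, h⟩).val else 0
  have hg : ∀ i (h : i < k), g i = (f ⟨i, h⟩).val := fun i h => dif_pos h
  have hinj : Set.InjOn g (range k) := by
    intro i hi j hj hij
    simp only [coe_range, Set.mem_Iio] at hi hj
    rw [hg i hi, hg j hj] at hij
    simpa using f.injective (Fin.ext hij)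
  have hadj : ∀ i, i + 1 < k → (g i < k - 1 - s ∧ g (i + 1) < k - 1 - s) ∨
      (g i < s ∧ k - 1 - s ≤ g (i + 1)) ∨ (k - 1 - s ≤ g i ∧ g (i + 1) < s) := by
    intro i hi
    rw [hg i (by omega), hg (i + 1) hi]
    have h : (SimpleGraph.pathGraph k).Adj ⟨i, by omega⟩ ⟨i + 1, hi⟩ :=
      SimpleGraph.pathGraph_adj.2 (Or.inl rfl)
    exact (f.toHom.map_adj h).2
  have hcard : ∀ A ⊆ range k, ∀ a b, (∀ i ∈ A, a ≤ g i ∧ g i < b) → #A ≤ b - a := by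
    intro A hA a b h
    rw [← Nat.card_Ico]
    exact card_le_card_of_injOn g (fun i hi => by simpa using h i hi)
      (hinj.mono (by exact_mod_cast hA))
  set X := (range k).filter fun i => g i < s with hX
  set Y := (range k).filter fun i => s ≤ g i ∧ g i < k - 1 - s with hY
  set Z := (range k).filter fun i => k - 1 - s ≤ g i with hZ
  have hXc : #X ≤ s - 0 := hcard X (filter_subset _ _) 0 s (by simp [hX])
  have hYc : #Y ≤ k - 1 - s - s := hcard Y (filter_subset _ _) s (k - 1 - s) (by
    intro i hi
    exact (mem_filter.1 hi).2)
  have hsucc : ∀ D ⊆ range k, (∀ i ∈ D, i + 1 < k → g (i + 1) < s) → #D ≤ #X + 1 := by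
    intro D hD h
    -- The final index has no successor and accounts for the `+ 1`.
    have h1 : #(D.erase (k - 1)) ≤ #X := by
      refine card_le_card_of_injOn (· + 1) (fun i hi => ?_) (fun i _ j _ hij => by simpa using hij)
      simp only [coe_erase, Set.mem_sdiff, mem_coe, Set.mem_singleton_iff] at hi
      have := mem_range.1 (hD hi.1)
      have h2 : i + 1 < k := by omega
      simpa [hX, h2] using h i hi.1 h2
    have := pred_card_le_card_erase (s := D) (a := k - 1)
    omega
  have hZsucc : ∀ i ∈ Z, i + 1 < k → g (i + 1) < s := by
    intro i hi h
    have h1 := (mem_filter.1 hi).2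
    have := hadj i h
    omega
  have hcover : k ≤ #X + #Y + #Z := by
    have : range k ⊆ X ∪ Y ∪ Z := by
      intro i hi
      simp only [hX, hY, hZ, mem_union, mem_filter, hi, true_and]
      omega
    calc k = #(range k) := (card_range k).symm
      _ ≤ _ := card_le_card this
      _ ≤ _ := card_union_le _ _
      _ ≤ _ := Nat.add_le_add_right (card_union_le _ _) _
  rcases Y.eq_empty_or_nonempty with hY0 | hYne
  · have := hsucc Z (filter_subset _ _) hZsucc
    rw [hY0, card_empty] at hcover
    omega
  · have hmem := Y.max'_mem hYne
    have hmax := fun i hi => Y.le_max' i hi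
    set i₀ := Y.max' hYne
    have h1 := hsucc (insert i₀ Z) (insert_subset (mem_filter.1 hmem).1 (filter_subset _ _)) (by
      intro i hi h
      rcases mem_insert.1 hi with rfl | hi
      · have h2 := (mem_filter.1 hmem).2
        have h3 := hadj _ h
        by_contra hcon
        have : i₀ + 1 ∈ Y := by
          rw [hY, mem_filter]
          exact ⟨mem_range.2 h, by omega, by omega⟩
        have := hmax _ this
        omega
      · exact hZsucc i hi h)
    rw [card_insert_of_notMem] at h1
    · omega
    · intro h
      have h2 := (mem_filter.1 hmem).2
      have h3 := (mem_filter.1 h).2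
      omega

/-- The spectral radius of a graph without a path on `k` vertices is bounded by those of the
extremal candidates. -/
theorem spectralRadius_le_of_free {n k : ℕ} (hn : 0 < n) {V : Type*} [Fintype V]
    (hV : Fintype.card V = n) (G : SimpleGraph V) (hG : (SimpleGraph.pathGraph k).Free G) {q : ℝ}
    (hW : ∀ s, 1 ≤ s → s ≤ k / 2 - 1 →
      signlessLaplacianSpectralRadius (graphW n (k - 1) s) ≤ q)
    (hK : signlessLaplacianSpectralRadius (SimpleGraph.completeGraph (Fin (k - 1))) ≤ q) :
    signlessLaplacianSpectralRadius G ≤ q := by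
  classical
  have : Nonempty V := Fintype.card_pos_iff.1 (by omega)
  obtain ⟨x, hx0, hx1, hx2⟩ := exists_nonneg_le_edgeForm G
  let e₀ : Fin n ≃ V := (Fintype.equivFinOfCardEq hV).symm
  -- Sorting by `-x` lists the vertices by decreasing weight.
  let e : Fin n ≃ V := (Tuple.sort fun i => -x (e₀ i)).trans e₀
  have hanti : Antitone fun i => x (e i) := by
    intro i j hij
    have := Tuple.monotone_sort (fun i => -x (e₀ i)) hij
    simpa [e] using this
  have hG' : ¬ HasPath (G.comap e) k := by
    rw [← pathGraph_isContained_iff_hasPath]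
    rwa [SimpleGraph.isContained_congr_right (SimpleGraph.Iso.comap e G)]
  obtain ⟨H, hH1, hH2, hH3⟩ := exists_isNested (G.comap e) hG' (fun i => x (e i))
    (fun i => hx0 _) hanti
  have h1 := hH1.edgeFormOn_le hH2 hanti (fun i => hx0 _) hW hK Finset.univ
  have h2 : edgeForm (G.comap e) (fun i => x (e i)) = edgeForm G x := by
    unfold edgeForm
    rw [← e.sum_comp]
    refine sum_congr rfl fun i _ => ?_
    rw [← e.sum_comp]
    rfl
  rw [edgeForm_eq_two_mul H, h2] at hH3
  rw [e.sum_comp (fun v => x v ^ 2)] at h1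
  exact le_of_mul_le_mul_right (by linarith) hx1

/-- `(SimpleGraph.pathGraph k).Free G` says that `G` has no (not necessarily induced) subgraph
isomorphic to the path on `k` vertices; `hmax` says that `G` has the largest signless Laplacian
spectral radius among all such graphs on `n` vertices. -/
theorem theorem4p14 (n k : ℕ) (hk : 4 ≤ k) (hkn : k ≤ n)
    {V : Type*} [Fintype V] (hV : Fintype.card V = n) (G : SimpleGraph V)
    (hG : (SimpleGraph.pathGraph k).Free G)
    (hmax : ∀ H : SimpleGraph V, (SimpleGraph.pathGraph k).Free H →
      signlessLaplacianSpectralRadius H ≤ signlessLaplacianSpectralRadius G) :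
    IsGreatest
      ({q : ℝ | ∃ s : ℕ, 1 ≤ s ∧ s ≤ k / 2 - 1 ∧
          q = signlessLaplacianSpectralRadius (graphW n (k - 1) s)} ∪
        {signlessLaplacianSpectralRadius (SimpleGraph.completeGraph (Fin (k - 1)))})
      (signlessLaplacianSpectralRadius G) := by
  set C := {q : ℝ | ∃ s : ℕ, 1 ≤ s ∧ s ≤ k / 2 - 1 ∧
    q = signlessLaplacianSpectralRadius (graphW n (k - 1) s)} ∪
      {signlessLaplacianSpectralRadius (SimpleGraph.completeGraph (Fin (k - 1)))} with hC
  have hub : ∀ q ∈ C, q ≤ signlessLaplacianSpectralRadius G := by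
    have : Nonempty (Fin n) := ⟨⟨0, by omega⟩⟩
    have : Nonempty (Fin (k - 1)) := ⟨⟨0, by omega⟩⟩
    let e : V ≃ Fin n := Fintype.equivFinOfCardEq hV
    rintro q (⟨s, hs1, hs2, rfl⟩ | rfl)
    · refine le_trans (signlessLaplacianSpectralRadius_le_of_injective_hom
        (H := (graphW n (k - 1) s).comap e) e.symm e.symm.injective ?_) (hmax _ ?_)
      · intro i j h
        simpa using h
      · rw [SimpleGraph.free_congr_right (SimpleGraph.Iso.comap e _)]
        exact graphW_free hs1 hs2
    · let f : Fin (k - 1) → V := fun i => e.symm ⟨i, by omega⟩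
      have hf : Function.Injective f := fun i j h => by
        simpa [f, Fin.ext_iff] using h
      refine le_trans (signlessLaplacianSpectralRadius_le_of_injective_hom
        (H := SimpleGraph.fromRel fun v w => v ∈ Set.range f ∧ w ∈ Set.range f) f hf ?_) (hmax _ ?_)
      · intro i j h
        simpa [SimpleGraph.fromRel_adj, hf.eq_iff] using h
      · rintro ⟨p⟩
        -- Every vertex of the path has a neighbour on it, and only the `k - 1` clique vertices have
        -- neighbours.
        have hp : ∀ i, p i ∈ Set.range f := by
          intro i
          obtain ⟨j, hj⟩ : ∃ j, (SimpleGraph.pathGraph k).Adj i j := by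
            rcases Nat.eq_zero_or_pos i.val with h | h
            · exact ⟨⟨1, by omega⟩, SimpleGraph.pathGraph_adj.2 (Or.inl (by simp [h]))⟩
            · exact ⟨⟨i.val - 1, by omega⟩, SimpleGraph.pathGraph_adj.2 (Or.inr (by simp; omega))⟩
          have := p.toHom.map_adj hj
          rw [SimpleGraph.fromRel_adj] at this
          rcases this.2 with h | h
          · exact h.1
          · exact h.2
        choose r hr using hp
        have hri : Function.Injective r := fun i j h => p.injective (by
          simp only [SimpleGraph.Copy.toHom_apply]
          rw [← hr i, ← hr j, h])
        have := Fintype.card_le_of_injective r hri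
        simp at this
        omega
  refine ⟨?_, hub⟩
  have hfin : C.Finite := by
    refine Set.Finite.union (Set.Finite.subset ((Set.finite_Iic (k / 2 - 1)).image fun s =>
      signlessLaplacianSpectralRadius (graphW n (k - 1) s)) ?_) (Set.finite_singleton _)
    rintro q ⟨s, -, hs, rfl⟩
    exact ⟨s, hs, rfl⟩
  obtain ⟨q, hq, hqmax⟩ := Set.exists_max_image C id hfin ⟨_, Or.inr rfl⟩
  have hle : signlessLaplacianSpectralRadius G ≤ q :=
    spectralRadius_le_of_free (by omega) hV G hG
      (fun s h1 h2 => hqmax _ (Or.inl ⟨s, h1, h2, rfl⟩)) (hqmax _ (Or.inr rfl))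
  rw [le_antisymm hle (hub q hq)]
  exact hq
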